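/- Let $\mathscr A$ be a finite-dimensional unital $C^\star$-algebra with dual $\mathscr A^\star$, and put $\{a,b\}=\tfrac12(ab+ba)$, $[[a,b]]=\tfrac1{2i}(ab-ba)$. A state is a positive linear functional $\rho$ on $\mathscr A$ with $\rho(1)=1$. Invertible elements $g$ act on states by $\rho\mapsto\rho(g^\dagger\,\cdot\,g)/\rho(g^\dagger g)$. Let $\mathcal O$ be an orbit of this action, regarded as an immersed submanifold of $\mathscr A^\star$. Its tangent space at $\rho$ consists of the functionals $c\mapsto\rho(\{a,c\})-\rho(a)\rho(c)+\rho([[b,c]])$ with $a,b\in\mathscr A$ self-adjoint. Every tangent vector at $\rho$ is of the form $\mathbb Y_a(\rho)\colon c\mapsto\rho(\{a,c\})-\rho(a)\rho(c)$ with $a$ self-adjoint, and the Jordan metric of $\mathcal O$ is the well-defined Riemannian metric $$\mathrm G_\rho(\mathbb Y_a(\rho),\mathbb Y_b(\rho))=\rho(\{a,b\})-\rho(a)\rho(b).$$ Let $(M,j,\mathcal O)$ be a parametric model of states on $\mathscr A$: $M$ is a smooth manifold (without boundary) and $j\colon M\to\mathcal O$ is a smooth map. Let $\mathrm G^M=j^*\mathrm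 G$. Let $\mathscr C_n$ be the $C^\star$-algebra of complex functions on a discrete space with $n$ points, and let $\Delta_n^+$ be the set of its faithful states, i.e. of the probability vectors $(p^1,\dots,p^n)$ with all $p^k>0$. The Jordan metric $\mathrm G_{FR}$ of $\Delta_n^+$ is the Fisher–Rao metric $\sum_k \xi^k\eta^k/p^k$. Let $\mathfrak m\colon\mathscr C_n\to\mathscr A$ be a positive unital linear map that is regular for the model: $j^c:=\mathfrak m^\star\circ j$, $j^c(m)=j(m)\circ\mathfrak m$, takes values in $\Delta_n^+$. Let $\mathrm G^{Mc}=(j^c)^*\mathrm G_{FR}$. Then, for every $m\in M$ and every $v\in T_mM$, $$\mathrm G^M_m(v,v)\ \ge\ \mathrm G^{Mc}_m(v,v).$$ -/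

import Mathlib

open scoped ComplexOrder Manifold ContDiff

namespace QState

/-! ### States of a `C⋆`-algebra and orbits of invertible elements -/

/-- A state: a positive linear functional `ρ` with `ρ 1 = 1`. The positive elements are those of the
form `star a * a`, and `0 ≤ z` for a complex number `z` means that `z` is real and nonnegative. -/
structure IsState {A : Type*} [CStarAlgebra A] (ρ : StrongDual ℂ A) : Prop where
  nonneg : ∀ a : A, 0 ≤ ρ (star a * a)
  map_one : ρ 1 = 1

/-- A positive functional is faithful if it vanishes on no nonzero positive element. -/
def IsFaithful {A : Type*} [CStarAlgebra A] (ρ : StrongDual ℂ A) : Prop :=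
  ∀ a : A, ρ (star a * a) = 0 → star a * a = 0

/-- The action of an invertible element `g` on states,
`(g • ρ)(c) = ρ (g† c g) / ρ (g† g)`. -/
noncomputable def act {A : Type*} [CStarAlgebra A] (g : Aˣ) (ρ : StrongDual ℂ A) :
    StrongDual ℂ A :=
  (ρ (star (g : A) * g))⁻¹ •
    (ρ ∘L ContinuousLinearMap.mul ℂ A (star (g : A)) ∘L (ContinuousLinearMap.mul ℂ A).flip (g : A))

/-- The orbit of `ρ` under the group of invertible elements. -/
def stateOrbit {A : Type*} [CStarAlgebra A] (ρ : StrongDual ℂ A) : Set (StrongDual ℂ A) :=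
  {σ | ∃ g : Aˣ, σ = act g ρ}

/-- The Jordan product `(c d + d c) / 2`. -/
noncomputable def jordanMul {A : Type*} [CStarAlgebra A] (c d : A) : A :=
  (1 / 2 : ℂ) • (c * d + d * c)

/-- The Lie product `(c d - d c) / (2 i)`. -/
noncomputable def lieMul {A : Type*} [CStarAlgebra A] (c d : A) : A :=
  (1 / (2 * Complex.I) : ℂ) • (c * d - d * c)

/-- The value at `ρ` of the fundamental vector field of the action labelled by `(a + i b) / 2`, as a
linear functional: `c ↦ ρ {a, c} - ρ a * ρ c + ρ [[b, c]]`. -/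
noncomputable def fundamentalVector {A : Type*} [CStarAlgebra A] (ρ : StrongDual ℂ A) (a b : A) :
    StrongDual ℂ A :=
  (1 / 2 : ℂ) • (ρ ∘L (ContinuousLinearMap.mul ℂ A a + (ContinuousLinearMap.mul ℂ A).flip a))
    - ρ a • ρ
    + (1 / (2 * Complex.I) : ℂ) •
      (ρ ∘L (ContinuousLinearMap.mul ℂ A b - (ContinuousLinearMap.mul ℂ A).flip b))

theorem fundamentalVector_apply {A : Type*} [CStarAlgebra A] (ρ : StrongDual ℂ A) (a b c : A) :
    fundamentalVector ρ a b c = ρ (jordanMul a c) - ρ a * ρ c + ρ (lieMul b c) := by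
  simp [fundamentalVector, jordanMul, lieMul]

/-- The gradient tangent vector `Y_a` at `ρ`. -/
noncomputable def gradientVector {A : Type*} [CStarAlgebra A] (ρ : StrongDual ℂ A) (a : A) :
    StrongDual ℂ A :=
  fundamentalVector ρ a 0

theorem gradientVector_apply {A : Type*} [CStarAlgebra A] (ρ : StrongDual ℂ A) (a c : A) :
    gradientVector ρ a c = ρ (jordanMul a c) - ρ a * ρ c := by
  simp [gradientVector, fundamentalVector_apply, lieMul]

/-- The tangent space at `ρ` of the orbit through `ρ`, which is spanned by the values of the
fundamental vector fields, as a real subspace of the dual of `A`. -/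
def orbitTangent {A : Type*} [CStarAlgebra A] (ρ : StrongDual ℂ A) :
    Submodule ℝ (StrongDual ℂ A) where
  carrier := {ξ | ∃ a b : A, IsSelfAdjoint a ∧ IsSelfAdjoint b ∧ ξ = fundamentalVector ρ a b}
  add_mem' := by
    rintro _ _ ⟨a, b, ha, hb, rfl⟩ ⟨a', b', ha', hb', rfl⟩
    refine ⟨a + a', b + b', ha.add ha', hb.add hb', ?_⟩
    ext c
    simp [fundamentalVector, add_mul]
    ring
  zero_mem' := by
    refine ⟨0, 0, .zero A, .zero A, ?_⟩
    ext c
    simp [fundamentalVector]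
  smul_mem' := by
    rintro r _ ⟨a, b, ha, hb, rfl⟩
    refine ⟨(r : ℂ) • a, (r : ℂ) • b, ?_, ?_, ?_⟩
    · exact IsSelfAdjoint.smul (by simp [IsSelfAdjoint]) ha
    · exact IsSelfAdjoint.smul (by simp [IsSelfAdjoint]) hb
    · ext c
      simp [fundamentalVector]
      ring

/-! ### Elementary facts on states, needed to see that the metric below is well defined -/

theorem IsState.star_mul_eq_zero {A : Type*} [CStarAlgebra A] {ρ : StrongDual ℂ A}
    (hρ : IsState ρ) (x y : A) (hx : ρ (star x * x) = 0) : ρ (star y * x) = 0 := by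
  let _ := CStarAlgebra.spectralOrder A
  let _ := CStarAlgebra.spectralOrderedRing A
  let f : A →ₚ[ℂ] ℂ := PositiveLinearMap.mk₀ (ρ : A →ₗ[ℂ] ℂ) (by
    intro a ha
    obtain ⟨b, rfl⟩ := CStarAlgebra.nonneg_iff_eq_star_mul_self.mp ha
    exact hρ.nonneg b)
  have h1 : ‖f.toPreGNS x‖ = 0 := by
    rw [PositiveLinearMap.preGNS_norm_def]
    have : f (star x * x) = 0 := hx
    simp [this]
  have h2 := norm_inner_le_norm (𝕜 := ℂ) (f.toPreGNS y) (f.toPreGNS x)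
  rw [h1, mul_zero, PositiveLinearMap.preGNS_inner_def] at h2
  exact norm_le_zero_iff.mp h2

theorem IsState.map_star {A : Type*} [CStarAlgebra A] {ρ : StrongDual ℂ A}
    (hρ : IsState ρ) (x : A) : ρ (star x) = star (ρ x) := by
  let _ := CStarAlgebra.spectralOrder A
  let _ := CStarAlgebra.spectralOrderedRing A
  let f : A →ₚ[ℂ] ℂ := PositiveLinearMap.mk₀ (ρ : A →ₗ[ℂ] ℂ) (by
    intro a ha
    obtain ⟨b, rfl⟩ := CStarAlgebra.nonneg_iff_eq_star_mul_self.mp ha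
    exact hρ.nonneg b)
  exact StarHomClass.map_star f x

theorem IsState.eq_zero {A : Type*} [CStarAlgebra A] {ρ : StrongDual ℂ A}
    (hρ : IsState ρ) (x : A) (hx : ρ (star x * x) = 0) : ρ x = 0 := by
  simpa using hρ.star_mul_eq_zero x 1 hx

theorem IsState.act {A : Type*} [CStarAlgebra A] {ρ : StrongDual ℂ A}
    (hρ : IsState ρ) (g : Aˣ) : IsState (act g ρ) := by
  have hne : ρ (star (g : A) * g) ≠ 0 := by
    intro h
    have := hρ.star_mul_eq_zero (g : A) (star ((g⁻¹ : Aˣ) : A)) h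
    simp [hρ.map_one] at this
  refine ⟨fun a => ?_, ?_⟩
  · have h1 := hρ.nonneg (g : A)
    have h2 := hρ.nonneg (a * g)
    simp only [QState.act, smul_apply, ContinuousLinearMap.comp_apply,
      ContinuousLinearMap.mul_apply', ContinuousLinearMap.flip_apply, smul_eq_mul]
    rw [star_mul] at h2
    refine mul_nonneg (inv_nonneg.mpr h1) ?_
    convert h2 using 2
    simp only [mul_assoc]
  · simp [QState.act, hne]

/-- A self-adjoint functional that vanishes on the self-adjoint null vectors of `ρ` is of the form
`c ↦ ρ {a, c}`. -/
theorem IsState.exists_jordan {A : Type*} [CStarAlgebra A] [FiniteDimensional ℂ A]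
    {ρ : StrongDual ℂ A} (hρ : IsState ρ) (ξ : StrongDual ℂ A)
    (hs : ∀ c, ξ (star c) = star (ξ c))
    (h0 : ∀ c, IsSelfAdjoint c → ρ (c * c) = 0 → ξ c = 0) :
    ∃ a, IsSelfAdjoint a ∧ ∀ c, ξ c = ρ (jordanMul a c) := by
  have : FiniteDimensional ℝ A := FiniteDimensional.complexToReal A
  let S := selfAdjoint.submodule ℝ A
  let B : S →ₗ[ℝ] Module.Dual ℝ S := LinearMap.mk₂ ℝ (fun a c => (ρ (a.1 * c.1)).re)
    (by intros; simp [add_mul]) (by intros; simp [← Complex.coe_smul])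
    (by intros; simp [mul_add]) (by intros; simp [← Complex.coe_smul])
  have hB : ∀ a c : S, B a c = (ρ (a.1 * c.1)).re := fun _ _ => rfl
  have hsa : ∀ a : S, IsSelfAdjoint a.1 := fun a => a.2
  have hsymm : ∀ a c : S, B a c = B c a := by
    intro a c
    have := hρ.map_star (a.1 * c.1)
    rw [star_mul, (hsa a).star_eq, (hsa c).star_eq] at this
    rw [hB, hB, this]
    simp
  let L : Module.Dual ℝ S :=
    { toFun := fun c => (ξ c.1).re
      map_add' := by intros; simp
      map_smul' := by intros; simp [← Complex.coe_smul] }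
  have hL : ∀ c : S, L c = (ξ c.1).re := fun _ => rfl
  have hmem : L ∈ LinearMap.range B.dualMap := by
    rw [LinearMap.range_dualMap_eq_dualAnnihilator_ker, Submodule.mem_dualAnnihilator]
    intro c hc
    have hc' : B c c = 0 := by rw [LinearMap.mem_ker.mp hc]; rfl
    rw [hB] at hc'
    have hnn := hρ.nonneg c.1
    rw [(hsa c).star_eq] at hnn
    have : ρ (c.1 * c.1) = 0 := by
      apply Complex.ext
      · simpa using hc'
      · simpa using (Complex.nonneg_iff.mp hnn).2.symm
    rw [hL, h0 c.1 (hsa c) this]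
    rfl
  obtain ⟨Ψ, hΨ⟩ := hmem
  obtain ⟨a, rfl⟩ := (Module.evalEquiv ℝ S).surjective Ψ
  have key : ∀ c : S, ξ c.1 = ρ (jordanMul a.1 c.1) := by
    intro c
    have h1 : L c = B c a := by rw [← hΨ]; rfl
    have h2 := hρ.map_star (a.1 * c.1)
    rw [star_mul, (hsa a).star_eq, (hsa c).star_eq] at h2
    have h3 := hs c.1
    rw [(hsa c).star_eq] at h3
    have h4 : (ξ c.1).im = 0 := by
      have := congrArg Complex.im h3
      simp at this
      linarith
    rw [hL, hB, h2] at h1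
    simp only [jordanMul, map_smul, map_add, h2]
    apply Complex.ext
    · simp at h1 ⊢
      linarith
    · simp [h4]
  refine ⟨a.1, hsa a, fun c => ?_⟩
  have hre := key ⟨realPart c, (realPart c).2⟩
  have him := key ⟨imaginaryPart c, (imaginaryPart c).2⟩
  simp only at hre him
  have hc := realPart_add_I_smul_imaginaryPart c
  conv_lhs => rw [← hc]
  conv_rhs => rw [← hc]
  rw [map_add, map_smul, hre, him]
  simp only [jordanMul, mul_add, add_mul, map_add, map_smul, mul_smul_comm, smul_mul_assoc,
    smul_eq_mul]
  ring

theorem IsState.exists_gradientVector_aux {A : Type*} [CStarAlgebra A] [FiniteDimensional ℂ A]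
    {ρ : StrongDual ℂ A} (hρ : IsState ρ) (ξ : StrongDual ℂ A)
    (hs : ∀ c, ξ (star c) = star (ξ c))
    (h0 : ∀ c, IsSelfAdjoint c → ρ (c * c) = 0 → ξ c = 0) (h1 : ξ 1 = 0) :
    ∃ a, IsSelfAdjoint a ∧ ξ = gradientVector ρ a := by
  obtain ⟨a, ha, h⟩ := hρ.exists_jordan ξ hs h0
  refine ⟨a, ha, ?_⟩
  have h2 : ρ a = 0 := by
    have := h 1
    rw [h1] at this
    simp only [jordanMul, mul_one, one_mul, map_smul, map_add, smul_eq_mul] at this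
    linear_combination -this
  ext c
  rw [gradientVector_apply, h2, h c]
  ring

/-- Every tangent vector of the orbit is a gradient tangent vector. -/
theorem IsState.exists_gradientVector {A : Type*} [CStarAlgebra A] [FiniteDimensional ℂ A]
    {ρ : StrongDual ℂ A} (hρ : IsState ρ) (ξ : orbitTangent ρ) :
    ∃ a, IsSelfAdjoint a ∧ (ξ : StrongDual ℂ A) = gradientVector ρ a := by
  obtain ⟨_, a, b, ha, hb, rfl⟩ := ξ
  have hmul : ∀ x y : A, IsSelfAdjoint x → ρ (star y * x) = star (ρ (x * y)) := by
    intro x y hx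
    rw [← hρ.map_star, star_mul, hx.star_eq]
  apply hρ.exists_gradientVector_aux
  · intro c
    have e1 : ρ (a * star c) = star (ρ (c * a)) := by
      rw [← hρ.map_star, star_mul, ha.star_eq]
    have e2 : ρ (star c * a) = star (ρ (a * c)) := hmul a c ha
    have e3 : ρ (b * star c) = star (ρ (c * b)) := by
      rw [← hρ.map_star, star_mul, hb.star_eq]
    have e4 : ρ (star c * b) = star (ρ (b * c)) := hmul b c hb
    have e5 : ρ a = star (ρ a) := by rw [← hρ.map_star, ha.star_eq]
    simp only [fundamentalVector_apply, jordanMul, lieMul, map_smul, map_add, map_sub, e1, e2, e3,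
      e4, hρ.map_star, smul_eq_mul]
    nth_rewrite 1 [e5]
    simp
    ring
  · intro c hc h
    have e0 : ρ (star c * c) = 0 := by rwa [hc.star_eq]
    have e1 : ∀ x, IsSelfAdjoint x → ρ (x * c) = 0 := by
      intro x hx
      have := hρ.star_mul_eq_zero c x e0
      rwa [hx.star_eq] at this
    have e2 : ∀ x, IsSelfAdjoint x → ρ (c * x) = 0 := by
      intro x hx
      have := hmul x c hx
      rw [e1 x hx, hc.star_eq] at this
      simpa using this
    simp [fundamentalVector_apply, jordanMul, lieMul, e1 a ha, e2 a ha, e1 b hb, e2 b hb,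
      hρ.eq_zero c e0]
  · simp [fundamentalVector_apply, jordanMul, lieMul, hρ.map_one]
    ring

/-! ### The Jordan metric -/

/-- The Jordan metric on the orbit through `ρ`: its value on the tangent vectors `Y_a`, `Y_b` is
`ρ {a, b} - ρ a * ρ b`. It is independent of the choice of `a` and `b`, see
`jordanMetric_gradientVector`. -/
noncomputable def jordanMetric {A : Type*} [CStarAlgebra A] [FiniteDimensional ℂ A]
    {ρ : StrongDual ℂ A} (hρ : IsState ρ) (ξ η : orbitTangent ρ) : ℝ :=
  let a := (hρ.exists_gradientVector ξ).choose
  let b := (hρ.exists_gradientVector η).choose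
  (ρ (jordanMul a b) - ρ a * ρ b).re

theorem jordanMul_comm {A : Type*} [CStarAlgebra A] (a b : A) : jordanMul a b = jordanMul b a := by
  simp [jordanMul, add_comm]

theorem jordanMetric_gradientVector {A : Type*} [CStarAlgebra A] [FiniteDimensional ℂ A]
    {ρ : StrongDual ℂ A} (hρ : IsState ρ) (ξ η : orbitTangent ρ) (a b : A)
    (ha : (ξ : StrongDual ℂ A) = gradientVector ρ a)
    (hb : (η : StrongDual ℂ A) = gradientVector ρ b) :
    jordanMetric hρ ξ η = (ρ (jordanMul a b) - ρ a * ρ b).re := by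
  have h1 := (hρ.exists_gradientVector ξ).choose_spec.2
  have h2 := (hρ.exists_gradientVector η).choose_spec.2
  set a' := (hρ.exists_gradientVector ξ).choose with ha'
  set b' := (hρ.exists_gradientVector η).choose with hb'
  have e : jordanMetric hρ ξ η = (ρ (jordanMul a' b') - ρ a' * ρ b').re := rfl
  have h3 : gradientVector ρ a' b' = gradientVector ρ a b' := by rw [← h1, ha]
  have h4 : gradientVector ρ b' a = gradientVector ρ b a := by rw [← h2, hb]
  rw [e, ← gradientVector_apply, h3, gradientVector_apply, jordanMul_comm a b', mul_comm (ρ a),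
    ← gradientVector_apply, h4, gradientVector_apply, jordanMul_comm b a, mul_comm (ρ b)]

/-! ### Smooth families of states and the pullback of the metric -/

/-- The derivative at a point of a smooth family of states on a manifold without boundary is a
tangent vector of the orbit through the state at that point. -/
theorem mfderiv_mem_orbitTangent {A : Type*} [CStarAlgebra A] [FiniteDimensional ℂ A]
    {E : Type*} [NormedAddCommGroup E] [NormedSpace ℝ E]
    {H : Type*} [TopologicalSpace H] (I : ModelWithCorners ℝ E H) [I.Boundaryless]
    {M : Type*} [TopologicalSpace M] [ChartedSpace H M]
    {j : M → StrongDual ℂ A} (hj : ∀ m, IsState (j m))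
    (hs : ContMDiff I 𝓘(ℝ, StrongDual ℂ A) ∞ j) (m : M) (v : TangentSpace I m) :
    (mfderiv I 𝓘(ℝ, StrongDual ℂ A) j m v : StrongDual ℂ A) ∈ orbitTangent (j m) := by
  have hd : MDifferentiableAt I 𝓘(ℝ, StrongDual ℂ A) j m := (hs m).mdifferentiableAt (by simp)
  set F : E → StrongDual ℂ A := writtenInExtChartAt I 𝓘(ℝ, StrongDual ℂ A) m j with hF
  set x : E := extChartAt I m m with hx
  have hFx : F x = j m := by simp only [hF, hx, writtenInExtChartAt, extChartAt_model_space_eq_id, PartialEquiv.refl_coe,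
      Function.comp_apply, id, extChartAt_to_inv]
  have hFs : ∀ y, IsState (F y) := by
    intro y
    simp only [hF, writtenInExtChartAt, extChartAt_model_space_eq_id, PartialEquiv.refl_coe,
      Function.comp_apply, id]
    exact hj _
  have hdF : DifferentiableAt ℝ F x := by
    have := hd.differentiableWithinAt_writtenInExtChartAt
    rwa [I.range_eq_univ, differentiableWithinAt_univ] at this
  have hmf : mfderiv I 𝓘(ℝ, StrongDual ℂ A) j m = fderiv ℝ F x := by
    exact hd.mfderiv.trans (by rw [I.range_eq_univ, fderivWithin_univ])
  rw [hmf]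
  let v' : E := v
  change fderiv ℝ F x v' ∈ _
  let ev : A → (StrongDual ℂ A →L[ℝ] ℂ) := fun c =>
    (ContinuousLinearMap.apply ℂ ℂ c).restrictScalars ℝ
  have hev : ∀ (L : ℂ →L[ℝ] ℝ) (c : A),
      HasFDerivAt (fun y => L (F y c)) ((L ∘L ev c) ∘L fderiv ℝ F x) x := fun L c =>
    ((L ∘L ev c).hasFDerivAt).comp x hdF.hasFDerivAt
  have hev' : ∀ (c : A), HasFDerivAt (fun y => F y c) ((ev c) ∘L fderiv ℝ F x) x := fun c =>
    ((ev c).hasFDerivAt).comp x hdF.hasFDerivAt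
  have hstar : ∀ c, fderiv ℝ F x v' (star c) = star (fderiv ℝ F x v' c) := by
    intro c
    have h1 := hev' (star c)
    have h2 := (hev' c)
    have h3 := (Complex.conjCLE.toContinuousLinearMap.hasFDerivAt).comp x h2
    have h4 : (fun y => F y (star c)) = (Complex.conjCLE.toContinuousLinearMap ∘ fun y => F y c) := by
      funext y
      simp [(hFs y).map_star]
    rw [h4] at h1
    have := congrArg (fun L => L v') (h1.unique h3)
    simpa [ev] using this
  have hone : fderiv ℝ F x v' 1 = 0 := by
    have h1 := hev' 1
    have h4 : (fun y => F y 1) = fun _ => (1 : ℂ) := by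
      funext y
      exact (hFs y).map_one
    rw [h4] at h1
    have := congrArg (fun L => L v') (h1.unique (hasFDerivAt_const (1 : ℂ) x))
    simpa [ev] using this
  have hpos : ∀ p : A, (∃ b, p = star b * b) → j m p = 0 → fderiv ℝ F x v' p = 0 := by
    rintro p ⟨b, rfl⟩ h
    have hmin : IsLocalMin (fun y => Complex.reCLM (F y (star b * b))) x := by
      refine Filter.Eventually.of_forall fun y => ?_
      simp only [hFx, h, map_zero]
      exact (Complex.nonneg_iff.mp ((hFs y).nonneg b)).1
    have h1 := congrArg (fun L => L v') (hmin.hasFDerivAt_eq_zero (hev Complex.reCLM _))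
    have h2 := hstar (star b * b)
    simp only [star_mul, star_star] at h2
    apply Complex.ext
    · simpa [ev] using h1
    · have := congrArg Complex.im h2
      simp at this
      simp
      linarith
  obtain ⟨a, ha, h⟩ := (hj m).exists_gradientVector_aux (fderiv ℝ F x v') hstar (by
    intro c hc h
    let _ := CStarAlgebra.spectralOrder A
    let _ := CStarAlgebra.spectralOrderedRing A
    have e0 : j m (star c * c) = 0 := by rwa [hc.star_eq]
    have hp := CFC.posPart_nonneg c
    have hn := CFC.negPart_nonneg c
    have hsub := CFC.posPart_sub_negPart c hc
    have hp' : j m c⁺ = 0 := by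
      apply (hj m).eq_zero
      have := (hj m).star_mul_eq_zero c c⁺ e0
      have e : c⁺ * c = c⁺ * c⁺ := by
        nth_rewrite 2 [← hsub]
        simp [mul_sub]
      rw [hp.isSelfAdjoint.star_eq, e] at this
      rwa [hp.isSelfAdjoint.star_eq]
    have hn' : j m c⁻ = 0 := by
      have := (hj m).eq_zero c e0
      rw [← hsub, map_sub, hp'] at this
      simpa using this
    rw [← hsub, map_sub, hpos _ (CStarAlgebra.nonneg_iff_eq_star_mul_self.mp hp) hp',
      hpos _ (CStarAlgebra.nonneg_iff_eq_star_mul_self.mp hn) hn', sub_zero]) hone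
  exact ⟨a, 0, ha, .zero A, h⟩

/-- The tangent map `T_m j` of a smooth family of states. -/
noncomputable def tangentVector {A : Type*} [CStarAlgebra A] [FiniteDimensional ℂ A]
    {E : Type*} [NormedAddCommGroup E] [NormedSpace ℝ E]
    {H : Type*} [TopologicalSpace H] (I : ModelWithCorners ℝ E H) [I.Boundaryless]
    {M : Type*} [TopologicalSpace M] [ChartedSpace H M]
    {j : M → StrongDual ℂ A} (hj : ∀ m, IsState (j m))
    (hs : ContMDiff I 𝓘(ℝ, StrongDual ℂ A) ∞ j) (m : M) (v : TangentSpace I m) :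
    orbitTangent (j m) :=
  ⟨mfderiv I 𝓘(ℝ, StrongDual ℂ A) j m v, mfderiv_mem_orbitTangent I hj hs m v⟩

/-- The pullback of the Jordan metric along a smooth family of states. -/
noncomputable def pullbackMetric {A : Type*} [CStarAlgebra A] [FiniteDimensional ℂ A]
    {E : Type*} [NormedAddCommGroup E] [NormedSpace ℝ E]
    {H : Type*} [TopologicalSpace H] (I : ModelWithCorners ℝ E H) [I.Boundaryless]
    {M : Type*} [TopologicalSpace M] [ChartedSpace H M]
    {j : M → StrongDual ℂ A} (hj : ∀ m, IsState (j m))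
    (hs : ContMDiff I 𝓘(ℝ, StrongDual ℂ A) ∞ j) (m : M) (v w : TangentSpace I m) : ℝ :=
  jordanMetric (hj m) (tangentVector I hj hs m v) (tangentVector I hj hs m w)

/-! ### Parametric models and measurement procedures -/

/-- A parametric model `(M, j, O)` of states on `A`: an orbit `O` of states and a smooth map
`j : M → O`. The orbit is an immersed submanifold of the dual of `A`; smoothness of `j` as a map
into the orbit is read as smoothness into that space, which it implies. -/
structure ParametricModel {E : Type*} [NormedAddCommGroup E] [NormedSpace ℝ E]
    {H : Type*} [TopologicalSpace H] (I : ModelWithCorners ℝ E H)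
    (M : Type*) [TopologicalSpace M] [ChartedSpace H M]
    (A : Type*) [CStarAlgebra A] where
  orbit : Set (StrongDual ℂ A)
  isOrbit : ∃ ρ, IsState ρ ∧ orbit = stateOrbit ρ
  j : M → StrongDual ℂ A
  mem_orbit : ∀ m, j m ∈ orbit
  smooth : ContMDiff I 𝓘(ℝ, StrongDual ℂ A) ∞ j

theorem ParametricModel.isState {E : Type*} [NormedAddCommGroup E] [NormedSpace ℝ E]
    {H : Type*} [TopologicalSpace H] {I : ModelWithCorners ℝ E H}
    {M : Type*} [TopologicalSpace M] [ChartedSpace H M]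
    {A : Type*} [CStarAlgebra A] (P : ParametricModel I M A) (m : M) : IsState (P.j m) := by
  obtain ⟨ρ, hρ, h⟩ := P.isOrbit
  have := P.mem_orbit m
  rw [h] at this
  obtain ⟨g, hg⟩ := this
  rw [hg]
  exact hρ.act g

/-- The tensor `G^M`, the pullback along `j` of the Jordan metric of the orbit. -/
noncomputable def ParametricModel.metric {E : Type*} [NormedAddCommGroup E] [NormedSpace ℝ E]
    {H : Type*} [TopologicalSpace H] {I : ModelWithCorners ℝ E H} [I.Boundaryless]
    {M : Type*} [TopologicalSpace M] [ChartedSpace H M]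
    {A : Type*} [CStarAlgebra A] [FiniteDimensional ℂ A] (P : ParametricModel I M A)
    (m : M) (v w : TangentSpace I m) : ℝ :=
  pullbackMetric I P.isState P.smooth m v w

instance finiteDimensional_continuousMap (n : ℕ) : FiniteDimensional ℂ C(Fin n, ℂ) :=
  FiniteDimensional.of_injective (ContinuousMap.coeFnLinearMap ℂ (M := ℂ) (α := Fin n))
    DFunLike.coe_injective

/-- A measurement procedure: a positive unital linear map from the continuous functions on an
outcome space with `n` points to `A`. -/
structure MeasurementProcedure (n : ℕ) (A : Type*) [CStarAlgebra A] where
  map : C(Fin n, ℂ) →L[ℂ] A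
  map_one : map 1 = 1
  map_pos : ∀ f : C(Fin n, ℂ), ∃ a : A, map (star f * f) = star a * a

/-- The dual map `𝔪⋆`, from functionals on `A` to functionals on `C(Fin n, ℂ)`. -/
noncomputable def MeasurementProcedure.dual {n : ℕ} {A : Type*} [CStarAlgebra A]
    (𝔪 : MeasurementProcedure n A) (ρ : StrongDual ℂ A) : StrongDual ℂ C(Fin n, ℂ) :=
  ρ ∘L 𝔪.map

/-- The map `j^c = 𝔪⋆ ∘ j`. -/
noncomputable def classicalMap {E : Type*} [NormedAddCommGroup E] [NormedSpace ℝ E]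
    {H : Type*} [TopologicalSpace H] {I : ModelWithCorners ℝ E H}
    {M : Type*} [TopologicalSpace M] [ChartedSpace H M]
    {A : Type*} [CStarAlgebra A] (P : ParametricModel I M A)
    {n : ℕ} (𝔪 : MeasurementProcedure n A) (m : M) : StrongDual ℂ C(Fin n, ℂ) :=
  𝔪.dual (P.j m)

/-- A measurement procedure is regular for a model if `j^c` takes values in the faithful states of
`C(Fin n, ℂ)`, that is, in the open simplex. -/
def MeasurementProcedure.IsRegular {E : Type*} [NormedAddCommGroup E] [NormedSpace ℝ E]
    {H : Type*} [TopologicalSpace H] {I : ModelWithCorners ℝ E H}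
    {M : Type*} [TopologicalSpace M] [ChartedSpace H M]
    {A : Type*} [CStarAlgebra A] {n : ℕ} (𝔪 : MeasurementProcedure n A)
    (P : ParametricModel I M A) : Prop :=
  ∀ m, IsState (classicalMap P 𝔪 m) ∧ IsFaithful (classicalMap P 𝔪 m)

theorem isState_classicalMap {E : Type*} [NormedAddCommGroup E] [NormedSpace ℝ E]
    {H : Type*} [TopologicalSpace H] {I : ModelWithCorners ℝ E H}
    {M : Type*} [TopologicalSpace M] [ChartedSpace H M]
    {A : Type*} [CStarAlgebra A] (P : ParametricModel I M A)
    {n : ℕ} (𝔪 : MeasurementProcedure n A) (m : M) : IsState (classicalMap P 𝔪 m) := by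
  refine ⟨fun f => ?_, ?_⟩
  · obtain ⟨a, ha⟩ := 𝔪.map_pos f
    change 0 ≤ P.j m (𝔪.map (star f * f))
    rw [ha]
    exact (P.isState m).nonneg a
  · change P.j m (𝔪.map 1) = 1
    rw [𝔪.map_one]
    exact (P.isState m).map_one

theorem contMDiff_classicalMap {E : Type*} [NormedAddCommGroup E] [NormedSpace ℝ E]
    {H : Type*} [TopologicalSpace H] {I : ModelWithCorners ℝ E H}
    {M : Type*} [TopologicalSpace M] [ChartedSpace H M]
    {A : Type*} [CStarAlgebra A] (P : ParametricModel I M A)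
    {n : ℕ} (𝔪 : MeasurementProcedure n A) :
    ContMDiff I 𝓘(ℝ, StrongDual ℂ C(Fin n, ℂ)) ∞ (classicalMap P 𝔪) := by
  let T : StrongDual ℂ A →L[ℝ] StrongDual ℂ C(Fin n, ℂ) :=
    (((ContinuousLinearMap.compL ℂ C(Fin n, ℂ) A ℂ).flip 𝔪.map)).restrictScalars ℝ
  have hT : ContDiff ℝ ∞ (T : StrongDual ℂ A → StrongDual ℂ C(Fin n, ℂ)) :=
    ContinuousLinearMap.contDiff (𝕜 := ℝ) (E := StrongDual ℂ A)
      (F := StrongDual ℂ C(Fin n, ℂ)) T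
  exact hT.contMDiff.comp P.smooth

/-- The tensor `G^{Mc}`, the pullback along `j^c` of the Fisher-Rao metric of the open simplex.
The latter is the Jordan metric of the commutative algebra `C(Fin n, ℂ)`; see
`jordanMetric_eq_fisherRao` for its coordinate expression. -/
noncomputable def classicalMetric {E : Type*} [NormedAddCommGroup E] [NormedSpace ℝ E]
    {H : Type*} [TopologicalSpace H] {I : ModelWithCorners ℝ E H} [I.Boundaryless]
    {M : Type*} [TopologicalSpace M] [ChartedSpace H M]
    {A : Type*} [CStarAlgebra A] (P : ParametricModel I M A)
    {n : ℕ} (𝔪 : MeasurementProcedure n A) (m : M) (v w : TangentSpace I m) : ℝ :=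
  pullbackMetric I (isState_classicalMap P 𝔪) (contMDiff_classicalMap P 𝔪) m v w

/-- The indicator function of a point of the outcome space. -/
def delta {n : ℕ} (k : Fin n) : C(Fin n, ℂ) := ⟨Pi.single k 1, continuous_of_discreteTopology⟩

theorem sum_delta {n : ℕ} (f : C(Fin n, ℂ)) : f = ∑ k, f k • delta k := by
  ext x
  simp [delta, ContinuousMap.sum_apply, Pi.single_apply]

/-- On faithful states of `C(Fin n, ℂ)`, with probabilities `p k = ρ (delta k)`, the Jordan metric
is the Fisher-Rao metric `∑ k, ξ k * η k / p k`. -/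
theorem jordanMetric_eq_fisherRao {n : ℕ} {ρ : StrongDual ℂ C(Fin n, ℂ)} (hρ : IsState ρ)
    (hf : IsFaithful ρ) (ξ η : orbitTangent ρ) :
    jordanMetric hρ ξ η =
      ∑ k, (ξ.1 (delta k)).re * (η.1 (delta k)).re / (ρ (delta k)).re := by
  obtain ⟨a, ha, h1⟩ := hρ.exists_gradientVector ξ
  obtain ⟨b, hb, h2⟩ := hρ.exists_gradientVector η
  rw [jordanMetric_gradientVector hρ ξ η a b h1 h2, h1, h2]
  have hsq : ∀ k : Fin n, star (delta k) * delta k = delta k := by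
    intro k; ext x; by_cases h : x = k <;> simp [delta, h]
  have hmul : ∀ (f : C(Fin n, ℂ)) (k : Fin n), jordanMul f (delta k) = f k • delta k := by
    intro f k; ext x
    by_cases h : x = k
    · subst h; simp [jordanMul, delta]; ring
    · simp [jordanMul, delta, h]
  have hreal : ∀ (f : C(Fin n, ℂ)), IsSelfAdjoint f → ∀ k, f k = ((f k).re : ℂ) := by
    intro f hf k
    have := congrArg (fun g : C(Fin n, ℂ) => g k) hf.star_eq
    simp only [ContinuousMap.star_apply] at this
    exact (Complex.conj_eq_iff_re.mp this).symm
  have hp : ∀ k : Fin n, ρ (delta k) = ((ρ (delta k)).re : ℂ) := by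
    intro k
    have := hρ.nonneg (delta k)
    rw [hsq] at this
    apply Complex.ext
    · simp
    · simpa using (Complex.nonneg_iff.mp this).2.symm
  have hp0 : ∀ k : Fin n, (ρ (delta k)).re ≠ 0 := by
    intro k h
    have h3 := hf (delta k) (by rw [hsq, hp k, h]; simp)
    rw [hsq] at h3
    have := congrArg (fun g : C(Fin n, ℂ) => g k) h3
    simp [delta] at this
  have hsum : ∀ f : C(Fin n, ℂ), IsSelfAdjoint f →
      ρ f = ((∑ k, (f k).re * (ρ (delta k)).re : ℝ) : ℂ) := by
    intro f hf
    conv_lhs => rw [sum_delta f]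
    rw [map_sum, Complex.ofReal_sum]
    refine Finset.sum_congr rfl fun k _ => ?_
    rw [map_smul, smul_eq_mul, Complex.ofReal_mul, ← hreal f hf k, ← hp k]
  have hone : ∑ k, (ρ (delta k)).re = 1 := by
    have := hsum 1 (.one _)
    rw [hρ.map_one] at this
    simp only [ContinuousMap.one_apply, Complex.one_re, one_mul] at this
    exact_mod_cast this.symm
  have hg : ∀ f : C(Fin n, ℂ), IsSelfAdjoint f → ∀ k, (gradientVector ρ f (delta k)).re =
      (ρ (delta k)).re * ((f k).re - (ρ f).re) := by
    intro f hf k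
    have e := hsum f hf
    have e2 : ρ f = ((ρ f).re : ℂ) := by rw [e]; simp
    rw [gradientVector_apply, hmul, map_smul, hreal f hf k, hp k, e2]
    simp
    ring
  have hJ : ρ (jordanMul a b) = ((∑ k, (a k).re * (b k).re * (ρ (delta k)).re : ℝ) : ℂ) := by
    have e : jordanMul a b = a * b := by ext x; simp [jordanMul]; ring
    rw [e, hsum (a * b) (by rw [IsSelfAdjoint, star_mul, ha.star_eq, hb.star_eq, mul_comm])]
    congr 1
    refine Finset.sum_congr rfl fun k _ => ?_
    rw [ContinuousMap.mul_apply, hreal a ha k, hreal b hb k]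
    simp
  have hterm : ∀ k, (gradientVector ρ a (delta k)).re * (gradientVector ρ b (delta k)).re /
      (ρ (delta k)).re = (a k).re * (b k).re * (ρ (delta k)).re
        - (ρ b).re * ((a k).re * (ρ (delta k)).re) - (ρ a).re * ((b k).re * (ρ (delta k)).re)
        + (ρ a).re * (ρ b).re * (ρ (delta k)).re := by
    intro k
    rw [hg a ha, hg b hb]
    field_simp [hp0 k]
    ring
  have ea := congrArg Complex.re (hsum a ha)
  have eb := congrArg Complex.re (hsum b hb)
  have ia := congrArg Complex.im (hsum a ha)
  rw [Complex.ofReal_re] at ea eb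
  rw [Complex.ofReal_im] at ia
  simp only [hterm]
  rw [Finset.sum_add_distrib, Finset.sum_sub_distrib, Finset.sum_sub_distrib, ← Finset.mul_sum,
    ← Finset.mul_sum, ← Finset.mul_sum, ← ea, ← eb, hone, hJ]
  simp only [Complex.sub_re, Complex.ofReal_re, Complex.mul_re, ia]
  ring

end QState

/-! Write the tangent vector at `ρ` as `Y_a` and its image under `𝔪⋆` as `Y_f`, based at `p = ρ ∘
𝔪`. The two squared lengths are then the variances `Var_ρ a` and `Var_p f`. Evaluating the image
vector at `f` itself in two ways gives `Var_p f = Cov_ρ(a, 𝔪 f)`, the covariance being taken with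
the Jordan product. So it is enough to have `2 Cov_ρ(a, 𝔪 f) ≤ Var_p f + Var_ρ a`: its left side is
twice `Var_p f`, and one copy cancels.

That inequality is a noncommutative completed square (`IsState.two_mul_re_jordanMul_map_le`). For
self-adjoint `x` and real `f`, the sum `∑ k, (f k - x) 𝔪(δ k) (f k - x)` is positive and, since the
effects `𝔪(δ k)` add up to `1`, equals `𝔪(f²) - x 𝔪(f) - 𝔪(f) x + x²`. Apply `ρ`, with `x` and `f`
replaced by their centred versions. No commutation between `x` and the effects is needed.

`jordanMetric_dual_le` is this argument at one state; the chain rule `mfderiv_classicalMap` carries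
it over to the pullbacks along `j` and `j^c`. -/

namespace QState

/-- Completing the square for a measurement procedure: the positive operators
`(f k - x) 𝔪(δ k) (f k - x)` have nonnegative expectations. -/
theorem IsState.two_mul_re_jordanMul_map_le {A : Type*} [CStarAlgebra A] {ρ : StrongDual ℂ A}
    (hρ : IsState ρ) {n : ℕ} (𝔪 : MeasurementProcedure n A) {x : A} (hx : IsSelfAdjoint x)
    {f : C(Fin n, ℂ)} (hf : IsSelfAdjoint f) :
    2 * (ρ (jordanMul x (𝔪.map f))).re ≤ (ρ (𝔪.map (f * f))).re + (ρ (x * x)).re := by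
  have hsq : ∀ k : Fin n, star (delta k) * delta k = delta k := by
    intro k; ext y; by_cases h : y = k <;> simp [delta, h]
  have hreal : ∀ k, star (f k) = f k := fun k => congrArg (fun g : C(Fin n, ℂ) => g k) hf.star_eq
  -- Each `delta k` is a projection, so positivity of `𝔪` factors its image as `𝔪 (delta k) = star
  -- (e k) * e k`; these are the effects of the measurement.
  choose e he using fun k : Fin n => 𝔪.map_pos (delta k)
  simp only [hsq] at he
  have hsum : ∀ g : C(Fin n, ℂ), 𝔪.map g = ∑ k, g k • (star (e k) * e k) := by
    intro g
    conv_lhs => rw [sum_delta g]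
    simp [map_sum, he]
  have hone : ∑ k, star (e k) * e k = 1 := by
    have := hsum 1
    rw [𝔪.map_one] at this
    simpa using this.symm
  -- The `k`-th term `(f k - x) 𝔪(δ k) (f k - x)`, written as `star y * y` so that `IsState.nonneg`
  -- applies. Realness of `f k` and self-adjointness of `x` make the two outer factors equal.
  have hterm : ∀ k, star (e k * (f k • 1 - x)) * (e k * (f k • 1 - x)) =
      (f k * f k) • (star (e k) * e k) - x * (f k • (star (e k) * e k))
        - (f k • (star (e k) * e k)) * x + x * (star (e k) * e k) * x := by
    intro k
    rw [star_mul, star_sub, star_smul, star_one, hreal, hx.star_eq]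
    simp only [sub_mul, mul_sub, smul_mul_assoc, mul_smul_comm, one_mul, mul_one, mul_assoc,
      smul_sub, mul_smul]
    abel
  -- Here `x` is independent of `k`, so it leaves the sums on either side, and `hone` collapses the
  -- last term to `x * x`.
  have htotal : ∑ k, star (e k * (f k • 1 - x)) * (e k * (f k • 1 - x)) =
      𝔪.map (f * f) - x * 𝔪.map f - 𝔪.map f * x + x * x := by
    simp only [hterm, Finset.sum_add_distrib, Finset.sum_sub_distrib, ← Finset.mul_sum,
      ← Finset.sum_mul, hone, mul_one]
    rw [hsum (f * f), hsum f]
    simp only [ContinuousMap.mul_apply]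
  have hnn : 0 ≤ ρ (𝔪.map (f * f) - x * 𝔪.map f - 𝔪.map f * x + x * x) := by
    rw [← htotal, map_sum]
    exact Finset.sum_nonneg fun k _ => hρ.nonneg _
  have hre := (Complex.nonneg_iff.mp hnn).1
  have hj : (ρ (jordanMul x (𝔪.map f))).re =
      ((ρ (x * 𝔪.map f)).re + (ρ (𝔪.map f * x)).re) / 2 := by
    simp [jordanMul]
    ring
  simp only [map_add, map_sub, Complex.add_re, Complex.sub_re] at hre
  linarith

theorem IsState.isSelfAdjoint_apply {A : Type*} [CStarAlgebra A] {ρ : StrongDual ℂ A}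
    (hρ : IsState ρ) {a : A} (ha : IsSelfAdjoint a) : IsSelfAdjoint (ρ a) := by
  rw [IsSelfAdjoint, ← hρ.map_star, ha.star_eq]

/-- Serves to centre: for `s = ρ a` and `t = ρ b` the right-hand side becomes the covariance `ρ {a,
b} - ρ a * ρ b`. -/
theorem IsState.apply_jordanMul_sub_smul_one {A : Type*} [CStarAlgebra A] {ρ : StrongDual ℂ A}
    (hρ : IsState ρ) (a b : A) (s t : ℂ) :
    ρ (jordanMul (a - s • 1) (b - t • 1)) = ρ (jordanMul a b) - t * ρ a - s * ρ b + s * t := by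
  simp [jordanMul, sub_mul, mul_sub, hρ.map_one]
  ring

theorem jordanMul_self {A : Type*} [CStarAlgebra A] (a : A) : jordanMul a a = a * a := by
  rw [jordanMul, ← two_smul ℂ (a * a), smul_smul]
  norm_num

/-- The Jordan metric is monotone under the dual of a measurement procedure. -/
theorem jordanMetric_dual_le {A : Type*} [CStarAlgebra A] [FiniteDimensional ℂ A]
    {ρ : StrongDual ℂ A} (hρ : IsState ρ) {n : ℕ} (𝔪 : MeasurementProcedure n A)
    (hρ' : IsState (𝔪.dual ρ)) (ξ : orbitTangent ρ) (η : orbitTangent (𝔪.dual ρ))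
    (hη : (η : StrongDual ℂ C(Fin n, ℂ)) = 𝔪.dual ξ) :
    jordanMetric hρ' η η ≤ jordanMetric hρ ξ ξ := by
  obtain ⟨a, ha, hξa⟩ := hρ.exists_gradientVector ξ
  obtain ⟨f, hf, hηf⟩ := hρ'.exists_gradientVector η
  rw [jordanMetric_gradientVector hρ ξ ξ a a hξa hξa,
    jordanMetric_gradientVector hρ' η η f f hηf hηf]
  have hd : ∀ g, 𝔪.dual ρ g = ρ (𝔪.map g) := fun _ => rfl
  -- Both sides are the number `η f`: the left because `η` is the gradient vector of `f`, the right
  -- because `η f = ξ (𝔪.map f)` and `ξ` is the gradient vector of `a`.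
  have hcov : ρ (𝔪.map (jordanMul f f)) - ρ (𝔪.map f) * ρ (𝔪.map f) =
      ρ (jordanMul a (𝔪.map f)) - ρ a * ρ (𝔪.map f) := by
    rw [← hd, ← hd, ← gradientVector_apply, hd, ← gradientVector_apply, ← hηf, ← hξa, hη]
    rfl
  have hx : IsSelfAdjoint (a - ρ a • 1) :=
    ha.sub ((hρ.isSelfAdjoint_apply ha).smul (.one A))
  have hg : IsSelfAdjoint (f - ρ (𝔪.map f) • 1) :=
    hf.sub ((hρ'.isSelfAdjoint_apply hf).smul (.one _))
  -- Since `𝔪` is unital, the centred `f` is mapped to the centred `𝔪.map f`, so this bounds twice a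
  -- covariance by the sum of the two variances.
  have key := hρ.two_mul_re_jordanMul_map_le 𝔪 hx hg
  rw [← jordanMul_self, ← jordanMul_self, map_sub, map_smul, 𝔪.map_one, ← hd (jordanMul _ _),
    hρ.apply_jordanMul_sub_smul_one, hρ.apply_jordanMul_sub_smul_one,
    hρ'.apply_jordanMul_sub_smul_one, hd, hd] at key
  have hre := congrArg Complex.re hcov
  rw [hd, hd]
  simp only [Complex.add_re, Complex.sub_re, mul_comm (ρ (𝔪.map f)) (ρ a)] at key hre ⊢
  linarith

/-- The tangent map of `j^c = 𝔪⋆ ∘ j` is the tangent map of `j` followed by `𝔪⋆`. -/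
theorem mfderiv_classicalMap {E : Type*} [NormedAddCommGroup E] [NormedSpace ℝ E]
    {H : Type*} [TopologicalSpace H] {I : ModelWithCorners ℝ E H}
    {M : Type*} [TopologicalSpace M] [ChartedSpace H M]
    {A : Type*} [CStarAlgebra A] (P : ParametricModel I M A)
    {n : ℕ} (𝔪 : MeasurementProcedure n A) (m : M) (v : TangentSpace I m) :
    (mfderiv I 𝓘(ℝ, StrongDual ℂ C(Fin n, ℂ)) (classicalMap P 𝔪) m v :
      StrongDual ℂ C(Fin n, ℂ)) =
      𝔪.dual (mfderiv I 𝓘(ℝ, StrongDual ℂ A) P.j m v : StrongDual ℂ A) := by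
  -- `𝔪⋆` as a continuous linear map, hence its own derivative; scalars are restricted because the
  -- manifold structure is real.
  let T : StrongDual ℂ A →L[ℝ] StrongDual ℂ C(Fin n, ℂ) :=
    (((ContinuousLinearMap.compL ℂ C(Fin n, ℂ) A ℂ).flip 𝔪.map)).restrictScalars ℝ
  have hj : HasMFDerivAt I 𝓘(ℝ, StrongDual ℂ A) P.j m _ :=
    ((P.smooth m).mdifferentiableAt (by simp)).hasMFDerivAt
  have hT : HasFDerivAt (𝕜 := ℝ) (E := StrongDual ℂ A) (F := StrongDual ℂ C(Fin n, ℂ))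
      T T (P.j m) :=
    ContinuousLinearMap.hasFDerivAt (𝕜 := ℝ) (E := StrongDual ℂ A)
      (F := StrongDual ℂ C(Fin n, ℂ)) T
  have hT' := HasFDerivAt.hasMFDerivAt (𝕜 := ℝ) (E := StrongDual ℂ A)
    (E' := StrongDual ℂ C(Fin n, ℂ)) hT
  have h := hT'.comp m hj
  exact congrArg (fun L => L v) h.mfderiv

end QState

theorem mainTheorem2 {E : Type*} [NormedAddCommGroup E] [NormedSpace ℝ E]
    {H : Type*} [TopologicalSpace H] (I : ModelWithCorners ℝ E H) [I.Boundaryless]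
    (M : Type*) [TopologicalSpace M] [ChartedSpace H M] [IsManifold I ∞ M]
    (A : Type*) [CStarAlgebra A] [FiniteDimensional ℂ A]
    (P : QState.ParametricModel I M A)
    (n : ℕ) (𝔪 : QState.MeasurementProcedure n A) (hreg : 𝔪.IsRegular P)
    (m : M) (v : TangentSpace I m) :
    QState.classicalMetric P 𝔪 m v v ≤ P.metric m v v :=
  -- The two placeholders are the tangent vectors of `j` and `j^c` along `v`; the chain rule
  -- supplies the relation required between them.
  QState.jordanMetric_dual_le (P.isState m) 𝔪 (QState.isState_classicalMap P 𝔪 m) _ _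
    (QState.mfderiv_classicalMap P 𝔪 m v)
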